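/- Throughout, graphs are simple; $H$ is finite. A $K_f$-minor is a graph $G$ together with a partition of its vertex set into $f$ non-empty sets $X_1,\dots,X_f$ such that each induced subgraph $G[X_i]$ is connected and, for all $i\ne j$, there is at least one edge of $G$ between $X_i$ and $X_j$. For an abelian group $(A,+)$, an $A$-weighted $K_f$-minor is a $K_f$-minor $G$ with a function $w:E(G)\to A$. A subdivision of a graph $H$ is a graph obtained from $H$ by replacing its edges by internally vertex-disjoint paths (the subdivision paths) connecting the original endpoints of the edges; the interior vertices of these paths are not vertices of $H$. For a finite abelian group $A$ put $$\sigma(A)=\max_{B\le A}\frac{|\{a\in A: 2a\in B\}|}{|B|},$$ the maximum being over all subgroups $B$ of $A$. **Theorem 1.3.** Let $H$ be a graph with $n$ vertices, $m$ edges and maximum degree at most $3$, and let $A$ be a finite abelian group. If $$f\ \ge\ 7m|A|+4n\,\sigma(A)+14|A|,$$ then every $A$-weighted $K_f$-minor $G$ contains, as a subgraph, an $A$-divisible subdivision of $H$, that is, a subdivision of $H$ such that for each of its subdivision paths the sum of the weights $w(e)$ over all edges $e$ of the path equals $0\in A$. -/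

import Mathlib

/-- The parameter `σ(A) = max_{B ≤ A} |{a ∈ A : 2a ∈ B}| / |B|` of a finite abelian group `A`.
Each quotient is a positive integer (`card_dvd_ncard_two_nsmul_mem`), so that natural-number
division is exact, and the supremum is attained (`isGreatest_sigmaParam`). -/
noncomputable def sigmaParam (A : Type*) [AddCommGroup A] : ℕ :=
  ⨆ B : AddSubgroup A, {a : A | 2 • a ∈ B}.ncard / Nat.card B

theorem card_dvd_ncard_two_nsmul_mem {A : Type*} [AddCommGroup A] (B : AddSubgroup A) :
    Nat.card B ∣ {a : A | 2 • a ∈ B}.ncard := by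
  have h : B ≤ B.comap (nsmulAddMonoidHom 2) := fun a ha => B.nsmul_mem ha 2
  exact AddSubgroup.card_dvd_of_le h

theorem isGreatest_sigmaParam (A : Type*) [AddCommGroup A] [Finite A] :
    IsGreatest (Set.range fun B : AddSubgroup A => {a : A | 2 • a ∈ B}.ncard / Nat.card B)
      (sigmaParam A) := by
  have hb : BddAbove
      (Set.range fun B : AddSubgroup A => {a : A | 2 • a ∈ B}.ncard / Nat.card B) :=
    (Set.finite_range _).bddAbove
  exact ⟨Nat.sSup_mem (Set.range_nonempty _) hb, fun _ hx => le_csSup hb hx⟩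

namespace SimpleGraph

/-- `G.CliqueMinor f`: the structure of a `K_f`-minor on the graph `G`, i.e. a partition of the
whole vertex set of `G` into `f` non-empty sets (the supernodes), each inducing a connected
subgraph, with at least one edge of `G` between any two of them. -/
structure CliqueMinor {V : Type*} (G : SimpleGraph V) (f : ℕ) where
  supernode : Fin f → Set V
  nonempty : ∀ i, (supernode i).Nonempty
  disjoint : ∀ i j, i ≠ j → Disjoint (supernode i) (supernode j)
  cover : ∀ v, ∃ i, v ∈ supernode i
  connected : ∀ i, (G.induce (supernode i)).Connected
  adj : ∀ i j, i ≠ j → ∃ x ∈ supernode i, ∃ y ∈ supernode j, G.Adj x y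

/-- The total weight of a walk in a graph whose edges are weighted by `w`
(for a path this is the sum of `w` over its set of edges). -/
def Walk.weight {V A : Type*} [AddCommGroup A] {G : SimpleGraph V} (w : G.edgeSet → A)
    {u v : V} (p : G.Walk u v) : A :=
  (p.edges.attach.map fun e => w ⟨e.1, p.edges_subset_edgeSet e.2⟩).sum

/-- A subdivision of `H` contained in `G` as a (not necessarily induced) subgraph: distinct branch
vertices for the vertices of `H`, and for every edge `uv` of `H` a path of `G` between the
branch vertices of `u` and `v` (listed once in each direction), such that a subdivision path meets
no branch vertices but its two ends, and two different subdivision paths have only branch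
vertices in common. -/
structure SubdivisionIn {U V : Type*} (H : SimpleGraph U) (G : SimpleGraph V) where
  branch : U → V
  branch_injective : Function.Injective branch
  path : ∀ u v, H.Adj u v → G.Walk (branch u) (branch v)
  isPath : ∀ u v (h : H.Adj u v), (path u v h).IsPath
  path_symm : ∀ u v (h : H.Adj u v), path v u h.symm = (path u v h).reverse
  eq_end_of_branch_mem : ∀ u v (h : H.Adj u v) (z : U),
    branch z ∈ (path u v h).support → z = u ∨ z = v
  internally_disjoint : ∀ u v (h : H.Adj u v) u' v' (h' : H.Adj u' v'), s(u, v) ≠ s(u', v') →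
    ∀ x, x ∈ (path u v h).support → x ∈ (path u' v' h').support → x ∈ Set.range branch

/-- A subdivision in a weighted graph is `A`-divisible if all its subdivision paths have
weight `0`. -/
def SubdivisionIn.IsDivisible {U V A : Type*} [AddCommGroup A] {H : SimpleGraph U}
    {G : SimpleGraph V} (S : H.SubdivisionIn G) (w : G.edgeSet → A) : Prop :=
  ∀ u v (h : H.Adj u v), (S.path u v h).weight w = 0

end SimpleGraph

/-! Fix an edge between any two supernodes and a spanning tree in each. A sequence of distinct
supernodes then determines a path of `G`, whose weight is a sum of edge terms and of turns inside
supernodes. All combinatorics takes place on these sequences.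

Choose a subgroup `B` modulo which inserting interior nodes into a route does not matter; initially
`B = ⊤`. As long as insertions still matter modulo the smaller subgroups that arise, disjoint
five-node gadgets offer two weights each, and concatenating them enlarges the set of attainable
weights until it fills a coset of `B`: this is a chain, costing at most `5|B|` nodes. If no gadget
is available, the remaining nodes are trivial modulo a proper subgroup, of at most half the order,
and the search restarts there (`IsTrivialMod.exists_chain_or`, `IsTrivialMod.exists_chains`). The
result is one chain per edge of `H`.

The remaining nodes form hubs, a centre with three leaves, which serve as branch vertices of degree
at most 3. Modulo the final subgroup, direct connections between hubs are additive and symmetric,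
hence 2-torsion; pigeonhole over at most `σ(A)` classes gives enough hubs with all connections
trivial (`IsTrivialMod.exists_hubs`). Routing an edge of `H` through its chain then allows its
weight to be corrected to exactly zero (`Chain.exists_run_eq_zero`). -/

/-- Weights on the routes through the nodes `ι`: `edge i j` is the weight of the step from `i` to
`j`, and `turn i j k` the weight of crossing `i` on the way from `j` to `k`. -/
structure RouteWeights (ι A : Type*) where
  edge : ι → ι → A
  turn : ι → ι → ι → A
  edge_comm : ∀ i j, edge i j = edge j i
  turn_comm : ∀ i j k, turn i j k = turn i k j

/-! ### Routes, triviality modulo a subgroup, and chains -/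

namespace RouteWeights

variable {ι A : Type*} [AddCommGroup A]

/-- The weight of the route `p :: q :: l`. -/
def run (R : RouteWeights ι A) : ι → ι → List ι → A
  | p, q, [] => R.edge p q
  | p, q, r :: l => R.edge p q + R.turn q p r + R.run q r l

theorem run_append (R : RouteWeights ι A) (p q k b a j : ι) (l l' : List ι) :
    R.run p q (l ++ k :: b :: a :: j :: l') = R.run p q (l ++ [k, b])
      + (R.turn b k a + R.edge b a + R.turn a b j) + R.run a j l' := by
  induction l generalizing p q with
  | nil => simp only [List.nil_append, run]; abel
  | cons x l ih => simp only [List.cons_append, run, ih]; abel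

/-- Modulo `B`, a node can be inserted into the interior of a route inside `N` without changing
the weight of the route. -/
def IsTrivialMod (R : RouteWeights ι A) (N : Finset ι) (B : AddSubgroup A) : Prop :=
  ∀ a j i k b, [a, j, i, k, b].Nodup → (∀ x ∈ [a, j, i, k, b], x ∈ N) →
    R.run a j [i, k, b] - R.run a j [k, b] ∈ B

theorem IsTrivialMod.mono {R : RouteWeights ι A} {N N' : Finset ι} {B : AddSubgroup A}
    (h : R.IsTrivialMod N B) (hN : N' ⊆ N) : R.IsTrivialMod N' B :=
  fun a j i k b h₁ h₂ => h a j i k b h₁ fun x hx => hN (h₂ x hx)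

/-- Delete the nodes of `m` one at a time, always the third of the route. Only the two nodes on
either side affect the change in weight, which is why triviality is tested on five nodes. -/
theorem IsTrivialMod.run_sub_mem {R : RouteWeights ι A} {N : Finset ι} {B : AddSubgroup A}
    (h : R.IsTrivialMod N B) (a j k b : ι) (m : List ι)
    (hnd : (a :: j :: (m ++ [k, b])).Nodup) (hN : ∀ x ∈ a :: j :: (m ++ [k, b]), x ∈ N) :
    R.run a j (m ++ [k, b]) - R.run a j [k, b] ∈ B := by
  induction m with
  | nil => simp
  | cons x m ih =>
    have h₁ := ih (hnd.sublist (by simp)) (fun y hy => hN y (by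
      simp only [List.mem_cons, List.mem_append, List.cons_append] at hy ⊢; tauto))
    obtain ⟨y, z, r, hr⟩ : ∃ y z r, m ++ [k, b] = y :: z :: r := by
      match m with
      | [] => exact ⟨_, _, _, rfl⟩
      | [y] => exact ⟨_, _, _, rfl⟩
      | y :: z :: r => exact ⟨_, _, _, rfl⟩
    rw [List.cons_append, hr] at hnd hN
    rw [hr] at h₁
    have h₂ := h a j x y z (hnd.sublist (by simp)) (fun u hu => hN u (by
      simp only [List.mem_cons] at hu ⊢; tauto))
    have h₃ := B.add_mem h₁ h₂
    rw [List.cons_append, hr]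
    convert h₃ using 1
    match r with
    | [] => simp only [run]; abel
    | w :: r => simp only [run]; abel

/-- Every element of `S` is the weight of a route `a, j, …, k, b` through nodes of `U`. -/
def Attains (R : RouteWeights ι A) (U : Finset ι) (a j k b : ι) (S : Set A) : Prop :=
  ∀ s ∈ S, ∃ l : List ι, (a :: j :: (l ++ [k, b])).Nodup ∧
    (∀ x ∈ a :: j :: (l ++ [k, b]), x ∈ U) ∧ R.run a j (l ++ [k, b]) = s

variable [DecidableEq ι]

/-- The weight of the junction depends only on the last two nodes of one route and the first two of
the other, so fixing these makes attainable sets add up to a translate. -/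
theorem Attains.append {R : RouteWeights ι A} {U U' : Finset ι} {a j k b a' j' k' b' : ι}
    {S S' : Set A} (h : R.Attains U a j k b S) (h' : R.Attains U' a' j' k' b' S')
    (hU : Disjoint U U') :
    R.Attains (U ∪ U') a j k' b'
      {x | ∃ s ∈ S, ∃ s' ∈ S', x = s + (R.turn b k a' + R.edge b a' + R.turn a' b j') + s'} := by
  rintro _ ⟨s, hs, s', hs', rfl⟩
  obtain ⟨l, hl₁, hl₂, rfl⟩ := h s hs
  obtain ⟨l', hl₁', hl₂', rfl⟩ := h' s' hs'
  have key : a :: j :: ((l ++ k :: b :: a' :: j' :: l') ++ [k', b']) =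
    (a :: j :: (l ++ [k, b])) ++ (a' :: j' :: (l' ++ [k', b'])) := by simp
  refine ⟨l ++ k :: b :: a' :: j' :: l', ?_, ?_, ?_⟩
  · rw [key]
    exact List.Nodup.append hl₁ hl₁' fun x hx hx' =>
      Finset.disjoint_left.mp hU (hl₂ x hx) (hl₂' x hx')
  · rw [key]
    intro x hx
    rcases List.mem_append.mp hx with hx | hx
    · exact Finset.mem_union_left _ (hl₂ x hx)
    · exact Finset.mem_union_right _ (hl₂' x hx)
  · rw [← run_append]; simp

/-- A chain for `B` inside `U`: routes with common first and last steps whose weights fill a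
coset of `B`. -/
structure Chain (R : RouteWeights ι A) where
  nodes : Finset ι
  fst : ι
  snd : ι
  penult : ι
  last : ι
  base : A
  sub : AddSubgroup A
  attains : R.Attains nodes fst snd penult last {x | x - base ∈ sub}

-- Growth by stabilizers: an attained set inside a coset of `B` either is stable under `B`, hence
-- the whole coset, or is enlarged by a five-node gadget whose two weights differ by a
-- non-stabilizing element of `B`.
open Pointwise in
theorem IsTrivialMod.exists_chain_or [Finite A] {R : RouteWeights ι A} {N : Finset ι}
    {B : AddSubgroup A} (h : R.IsTrivialMod N B) (hN : 4 ≤ N.card) :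
    (∃ C : R.Chain, C.nodes ⊆ N ∧ C.sub = B ∧ C.nodes.card ≤ 5 * Nat.card B) ∨
    ∃ N' ⊆ N, ∃ B' < B, N.card ≤ N'.card + 5 * Nat.card B ∧ R.IsTrivialMod N' B' := by
  classical
  have := Fintype.ofFinite A
  by_contra! hcon
  obtain ⟨hC, hT⟩ := hcon
  have card_le : ∀ (S : Finset A) (s₀ : A), (∀ s ∈ S, s - s₀ ∈ B) → S.card ≤ Nat.card B := by
    intro S s₀ hS
    have := Nat.card_le_card_of_injective (fun s : S => (⟨s - s₀, hS s s.2⟩ : B)) fun s t hst =>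
      Subtype.ext (sub_left_injective (Subtype.ext_iff.mp hst))
    simpa using this
  -- Four nodes give the first weight and each further weight costs at most five, hence at most `5 *
  -- t - 1` nodes.
  have key : ∀ t : ℕ, 1 ≤ t → ∃ U ⊆ N, ∃ a j k b, ∃ S : Finset A, ∃ s₀,
      R.Attains U a j k b S ∧ U.card + 1 ≤ 5 * t ∧ t ≤ S.card ∧ ∀ s ∈ S, s - s₀ ∈ B := by
    intro t ht
    induction t, ht using Nat.le_induction with
    | base =>
      obtain ⟨U, hU, hc⟩ := Finset.exists_subset_card_eq hN
      obtain ⟨l, hl, rfl⟩ : ∃ l : List ι, l.Nodup ∧ l.toFinset = U :=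
        ⟨U.toList, U.nodup_toList, by simp⟩
      rw [List.toFinset_card_of_nodup hl] at hc
      match l, hc with
      | [a, j, k, b], _ =>
        refine ⟨_, hU, a, j, k, b, {R.run a j [k, b]}, R.run a j [k, b], ?_, ?_, ?_, ?_⟩
        · intro s hs
          exact ⟨[], hl, by simp, (Finset.mem_singleton.mp hs).symm⟩
        · rw [List.toFinset_card_of_nodup hl]; simp
        · simp
        · simp
    | succ t ht ih =>
      obtain ⟨U, hU, a, j, k, b, S, s₀, hS, hUc, htS, hB⟩ := ih
      have htB : t ≤ Nat.card B := htS.trans (card_le S s₀ hB)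
      by_cases hst : B ≤ AddAction.stabilizer A S
      · -- the weights attained fill a coset of `B`
        obtain ⟨s₁, hs₁⟩ : S.Nonempty := Finset.card_pos.mp (by omega)
        refine absurd (hC ⟨U, a, j, k, b, s₁, B, ?_⟩ hU rfl) (by simp only; omega)
        intro x hx
        refine hS x ?_
        have hmem := Finset.vadd_mem_vadd_finset (a := x - s₁) hs₁
        rw [AddAction.mem_stabilizer_iff.mp (hst hx)] at hmem
        simpa using hmem
      · have hlt : AddAction.stabilizer A S ⊓ B < B :=
          lt_of_le_of_ne inf_le_right fun he => hst (inf_eq_right.mp he)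
        -- If the nodes outside `U` were trivial modulo this smaller subgroup, the second
        -- alternative would hold.
        have hnt := hT (N \ U) Finset.sdiff_subset _ hlt (by
          rw [Finset.card_sdiff_of_subset hU]; have := Finset.card_le_card hU; omega)
        simp only [IsTrivialMod, not_forall] at hnt
        obtain ⟨a', j', i', k', b', hnd, hmem, hd⟩ := hnt
        have hdB := h a' j' i' k' b' hnd fun x hx => (Finset.mem_sdiff.mp (hmem x hx)).1
        set w₁ := R.run a' j' [i', k', b'] with hw₁
        set w₀ := R.run a' j' [k', b'] with hw₀
        have hU' : R.Attains [a', j', i', k', b'].toFinset a' j' k' b' {w₀, w₁} := by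
          rintro s (rfl | rfl)
          · refine ⟨[], hnd.sublist (by simp), ?_, rfl⟩
            simp only [List.mem_toFinset, List.mem_cons, List.nil_append]
            tauto
          · exact ⟨[i'], hnd, by simp, rfl⟩
        have hdisj : Disjoint U [a', j', i', k', b'].toFinset :=
          Finset.disjoint_right.mpr fun x hx =>
            (Finset.mem_sdiff.mp (hmem x (List.mem_toFinset.mp hx))).2
        have hS' := hS.append hU' hdisj
        set c := R.turn b k a' + R.edge b a' + R.turn a' b j'
        refine ⟨_, Finset.union_subset hU fun x hx =>
          (Finset.mem_sdiff.mp (hmem x (List.mem_toFinset.mp hx))).1, a, j, k', b',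
          (c + w₀) +ᵥ (S ∪ ((w₁ - w₀) +ᵥ S)), c + w₀ + s₀, ?_, ?_, ?_, ?_⟩
        · intro x hx
          refine hS' x ?_
          rw [Finset.mem_coe, Finset.mem_vadd_finset] at hx
          obtain ⟨y, hy, rfl⟩ := hx
          rcases Finset.mem_union.mp hy with hy | hy
          · exact ⟨y, hy, w₀, by simp, by simp only [vadd_eq_add]; abel⟩
          · obtain ⟨z, hz, rfl⟩ := Finset.mem_vadd_finset.mp hy
            exact ⟨z, hz, w₁, by simp, by simp only [vadd_eq_add]; abel⟩
        · have h₁ := Finset.card_union_le U [a', j', i', k', b'].toFinset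
          rw [List.toFinset_card_of_nodup hnd] at h₁
          simp only [List.length_cons, List.length_nil] at h₁
          omega
        · rw [Finset.card_vadd_finset]
          refine Nat.succ_le_of_lt (htS.trans_lt (Finset.card_lt_card ?_))
          refine Finset.ssubset_iff_subset_ne.mpr ⟨Finset.subset_union_left, fun he => hd ?_⟩
          refine ⟨AddAction.mem_stabilizer_iff.mpr ?_, hdB⟩
          exact Finset.eq_of_subset_of_card_le (Finset.union_eq_left.mp he.symm)
            (by rw [Finset.card_vadd_finset])
        · intro x hx
          obtain ⟨y, hy, rfl⟩ := Finset.mem_vadd_finset.mp hx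
          rcases Finset.mem_union.mp hy with hy | hy
          · simpa [add_sub_add_left_eq_sub] using hB y hy
          · obtain ⟨z, hz, rfl⟩ := Finset.mem_vadd_finset.mp hy
            convert B.add_mem hdB (hB z hz) using 1
            simp only [vadd_eq_add]; abel
  -- More than `|B|` weights cannot fit in one coset of `B`.
  obtain ⟨-, -, -, -, -, -, S, s₀, -, -, hS, hB⟩ := key (Nat.card B + 1) (by omega)
  have := card_le S s₀ hB
  omega

/-- Disjoint chains for subgroups containing the subgroup `B'` that is left. -/
theorem IsTrivialMod.exists_chains [Finite A] {R : RouteWeights ι A} (r : ℕ) (m : ℕ)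
    {N : Finset ι} {B : AddSubgroup A} (h : R.IsTrivialMod N B)
    (hN : 7 * m * Nat.card B + 14 * Nat.card B + r ≤ N.card) :
    ∃ C : Fin m → R.Chain, ∃ N' ⊆ N, ∃ B' ≤ B, R.IsTrivialMod N' B' ∧ r + 14 ≤ N'.card ∧
      (∀ i, (C i).nodes ⊆ N) ∧ (∀ i, B' ≤ (C i).sub) ∧ (∀ i, Disjoint (C i).nodes N') ∧
      (∀ i j, i ≠ j → Disjoint (C i).nodes (C j).nodes) ∧
      ∀ i, R.IsTrivialMod ((C i).nodes ∪ N') (C i).sub := by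
  obtain ⟨c, hc⟩ : ∃ c, c = Nat.card B := ⟨_, rfl⟩
  induction c using Nat.strong_induction_on generalizing m N B with
  | _ c ihc =>
  induction m generalizing N with
  | zero =>
    have := Nat.card_pos (α := B)
    exact ⟨Fin.elim0, N, subset_rfl, B, le_rfl, h, by omega, by simp, by simp, by simp,
      by simp, by simp⟩
  | succ m ihm =>
    have hpos := Nat.card_pos (α := B)
    have hmul : 7 * (m + 1) * Nat.card B = 7 * m * Nat.card B + 7 * Nat.card B := by ring
    rcases h.exists_chain_or (by omega) with ⟨C₀, hC₀, rfl, hcard⟩ | ⟨N₁, hN₁, B₁, hB₁, hcard, h₁⟩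
    · obtain ⟨C, N', hN', B', hB', ht, hr, h₂, h₃, h₄, h₅, h₆⟩ :=
        ihm (N := N \ C₀.nodes) (h.mono Finset.sdiff_subset) (by
          rw [Finset.card_sdiff_of_subset hC₀]; omega)
      refine ⟨Fin.cons C₀ C, N', hN'.trans Finset.sdiff_subset, B', hB', ht, hr, ?_, ?_, ?_, ?_, ?_⟩
      · exact Fin.cases hC₀ fun i => (h₂ i).trans Finset.sdiff_subset
      · exact Fin.cases hB' h₃
      · exact Fin.cases (Finset.disjoint_sdiff.mono_right hN') h₄
      · refine Fin.cases (Fin.cases (fun h => absurd rfl h) fun j _ => ?_)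
          fun i => Fin.cases (fun _ => ?_) fun j hij => ?_
        · exact Finset.disjoint_sdiff.mono_right (h₂ j)
        · exact (Finset.disjoint_sdiff.mono_right (h₂ i)).symm
        · exact h₅ i j fun he => hij (he ▸ rfl)
      · exact Fin.cases (h.mono (Finset.union_subset hC₀ (hN'.trans Finset.sdiff_subset))) h₆
    -- Halving the order frees at least `7|B|` of the reserve `14|B|`, which pays for the at most
    -- `5|B|` discarded nodes.
    · have h2 : 2 * Nat.card B₁ ≤ Nat.card B := by
        obtain ⟨q, hq⟩ := AddSubgroup.card_dvd_of_le hB₁.le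
        have hne : Nat.card B₁ ≠ Nat.card B := fun he =>
          hB₁.ne (AddSubgroup.eq_of_le_of_card_ge hB₁.le he.ge)
        have hq2 : 2 ≤ q := by
          by_contra! hlt
          interval_cases q <;> omega
        rw [hq]; nlinarith
      have hpos₁ := Nat.card_pos (α := B₁)
      obtain ⟨C, N', hN', B', hB', ht, hr, h₂, h₃⟩ :=
        ihc (Nat.card B₁) (by omega) (m + 1) h₁ (by
          have : 7 * (m + 1) * Nat.card B₁ ≤ 7 * (m + 1) * Nat.card B :=
            Nat.mul_le_mul_left _ (by omega)
          omega) rfl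
      exact ⟨C, N', hN'.trans hN₁, B', hB'.trans hB₁.le, ht, hr, fun i => (h₂ i).trans hN₁, h₃⟩

end RouteWeights

/-! ### Hubs and their pairwise connections -/

namespace RouteWeights

variable {ι A : Type*} [AddCommGroup A]

/-- A centre node with three leaf nodes; `leg i` is the weight of the way from a branch vertex in
the centre towards the leaf `i`. -/
structure Hub (R : RouteWeights ι A) where
  ctr : ι
  leaf : Fin 3 → ι
  leg : Fin 3 → A
  leaf_injective : Function.Injective leaf
  leaf_ne_ctr : ∀ i, leaf i ≠ ctr
  leg_add : ∀ i j, i ≠ j → leg i + leg j = R.turn ctr (leaf i) (leaf j)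

namespace Hub

variable {R : RouteWeights ι A}

/-- The nodes of a hub. -/
def nodes (x : R.Hub) : Set ι := insert x.ctr (Set.range x.leaf)

theorem ctr_mem (x : R.Hub) : x.ctr ∈ x.nodes := Set.mem_insert _ _

theorem leaf_mem (x : R.Hub) (i : Fin 3) : x.leaf i ∈ x.nodes := Or.inr ⟨i, rfl⟩

/-- The weight of the direct way between the branch vertices of two hubs through given leaves. -/
def link (x : R.Hub) (i : Fin 3) (y : R.Hub) (j : Fin 3) : A :=
  x.leg i + R.run x.ctr (x.leaf i) [y.leaf j, y.ctr] + y.leg j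

theorem link_comm (x : R.Hub) (i : Fin 3) (y : R.Hub) (j : Fin 3) :
    x.link i y j = y.link j x i := by
  simp only [link, run]
  rw [R.edge_comm x.ctr, R.edge_comm y.ctr, R.edge_comm (x.leaf i) (y.leaf j),
    R.turn_comm (x.leaf i), R.turn_comm (y.leaf j)]
  abel

/-- Entering and leaving `y` by different leaves makes the two legs one turn, so the links
concatenate to a route from `x` to `z`; deleting the nodes of `y` leaves the direct link. -/
theorem link_add_link_sub_mem {N : Finset ι} {B : AddSubgroup A} (h : R.IsTrivialMod N B)
    {x y z : R.Hub} (hx : x.nodes ⊆ N) (hy : y.nodes ⊆ N) (hz : z.nodes ⊆ N)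
    (hxy : Disjoint x.nodes y.nodes) (hyz : Disjoint y.nodes z.nodes)
    (hxz : Disjoint x.nodes z.nodes) (i k : Fin 3) {j j' : Fin 3} (hj : j ≠ j') :
    x.link i y j + y.link j' z k - x.link i z k ∈ B := by
  have := h.run_sub_mem x.ctr (x.leaf i) (z.leaf k) z.ctr [y.leaf j, y.ctr, y.leaf j'] (by
      have n₁ := hxy.ne_of_mem x.ctr_mem y.ctr_mem
      have n₂ := fun j => hxy.ne_of_mem x.ctr_mem (y.leaf_mem j)
      have n₃ := hxz.ne_of_mem x.ctr_mem z.ctr_mem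
      have n₄ := hxz.ne_of_mem x.ctr_mem (z.leaf_mem k)
      have n₅ := hxy.ne_of_mem (x.leaf_mem i) y.ctr_mem
      have n₆ := fun j => hxy.ne_of_mem (x.leaf_mem i) (y.leaf_mem j)
      have n₇ := hxz.ne_of_mem (x.leaf_mem i) z.ctr_mem
      have n₈ := hxz.ne_of_mem (x.leaf_mem i) (z.leaf_mem k)
      have m₁ := hyz.ne_of_mem y.ctr_mem z.ctr_mem
      have m₂ := hyz.ne_of_mem y.ctr_mem (z.leaf_mem k)
      have m₃ := fun j => hyz.ne_of_mem (y.leaf_mem j) z.ctr_mem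
      have m₄ := fun j => hyz.ne_of_mem (y.leaf_mem j) (z.leaf_mem k)
      simp [n₁, n₂, n₃, n₄, n₅, n₆, n₇, n₈, m₁, m₂, m₃, m₄, (x.leaf_ne_ctr i).symm,
        y.leaf_ne_ctr j, (y.leaf_ne_ctr j').symm, z.leaf_ne_ctr k, y.leaf_injective.ne hj])
    (by simpa using ⟨hx x.ctr_mem, hx (x.leaf_mem i), hy (y.leaf_mem j), hy y.ctr_mem,
      hy (y.leaf_mem j'), hz (z.leaf_mem k), hz z.ctr_mem⟩)
  convert this using 1
  have hl := y.leg_add j j' hj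
  simp only [link, run, List.cons_append, List.nil_append, ← hl]
  abel

/-- Go from an auxiliary hub `x` to `z` through `y`, entering by a leaf other than `j` and `j'`;
both exits compare with the same direct link. -/
theorem link_sub_link_mem {N : Finset ι} {B : AddSubgroup A} (h : R.IsTrivialMod N B)
    {x y z : R.Hub} (hx : x.nodes ⊆ N) (hy : y.nodes ⊆ N) (hz : z.nodes ⊆ N)
    (hxy : Disjoint x.nodes y.nodes) (hyz : Disjoint y.nodes z.nodes)
    (hxz : Disjoint x.nodes z.nodes) (j j' k : Fin 3) :
    y.link j z k - y.link j' z k ∈ B := by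
  obtain ⟨i, hi, hi'⟩ : ∃ i : Fin 3, i ≠ j ∧ i ≠ j' := by decide +revert
  convert B.sub_mem (link_add_link_sub_mem h hx hy hz hxy hyz hxz 0 k hi)
    (link_add_link_sub_mem h hx hy hz hxy hyz hxz 0 k hi') using 1
  abel

end Hub

/-- Every class killed by 2 has `|B|` lifts `a`, all with `2a ∈ B`. -/
theorem card_two_torsion_quotient_le [Finite A] (B : AddSubgroup A) :
    {q : A ⧸ B | 2 • q = 0}.ncard ≤ sigmaParam A := by
  refine le_trans ?_ ((isGreatest_sigmaParam A).2 ⟨B, rfl⟩)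
  rw [Nat.le_div_iff_mul_le Nat.card_pos]
  rw [← Nat.card_coe_set_eq, ← Nat.card_coe_set_eq, ← Nat.card_prod]
  have hmem (p : {q : A ⧸ B | 2 • q = 0} × B) : 2 • (p.1.1.out + p.2.1) ∈ B := by
    rw [← QuotientAddGroup.eq_zero_iff, smul_add]
    have h := p.1.2
    simp only [Set.mem_ofPred_eq] at h
    have h₂ : ((2 • p.2.1 : A) : A ⧸ B) = 0 :=
      (QuotientAddGroup.eq_zero_iff _).mpr (B.nsmul_mem p.2.2 2)
    rw [QuotientAddGroup.mk_add, h₂, QuotientAddGroup.mk_nsmul, QuotientAddGroup.out_eq', h,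
      add_zero]
  refine Nat.card_le_card_of_injective
    (fun p => (⟨p.1.1.out + p.2.1, hmem p⟩ : {a : A | 2 • a ∈ B})) ?_
  rintro ⟨⟨q, hq⟩, b, hb⟩ ⟨⟨q', hq'⟩, b', hb'⟩ he
  have he' : q.out + b = q'.out + b' := Subtype.ext_iff.mp he
  have hqq : q = q' := by
    have := congrArg (QuotientAddGroup.mk : A → A ⧸ B) he'
    rw [QuotientAddGroup.mk_add, QuotientAddGroup.mk_add,
      (QuotientAddGroup.eq_zero_iff b).mpr hb, (QuotientAddGroup.eq_zero_iff b').mpr hb'] at this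
    simpa using this
  subst hqq
  simpa using he'

/-- Among sufficiently many disjoint hubs there are `n` that are pairwise at distance zero. -/
theorem IsTrivialMod.exists_hubs [Finite A] {R : RouteWeights ι A} {N : Finset ι}
    {B : AddSubgroup A} (h : R.IsTrivialMod N B) {κ : Type*} [Fintype κ] (x : κ → R.Hub)
    (hx : ∀ u, (x u).nodes ⊆ N) (hd : Pairwise fun u v => Disjoint (x u).nodes (x v).nodes)
    (n : ℕ) (hn : n * sigmaParam A + 3 ≤ Fintype.card κ) :
    ∃ s : Finset κ, n ≤ s.card ∧
      ∀ u ∈ s, ∀ v ∈ s, u ≠ v → ∀ i j, (x u).link i (x v) j ∈ B := by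
  classical
  have := Fintype.ofFinite (A ⧸ B)
  have hthird : ∀ u v : κ, ∃ t, t ≠ u ∧ t ≠ v := by
    intro u v
    by_contra! hcon
    have hsub : (Finset.univ : Finset κ) ⊆ {u, v} := fun t _ => by
      have := hcon t
      simp only [Finset.mem_insert, Finset.mem_singleton]
      tauto
    have := (Finset.card_le_card hsub).trans Finset.card_le_two
    rw [Finset.card_univ] at this
    omega
  let p (u v : κ) : A ⧸ B := ((x u).link 0 (x v) 0 : A)
  have hmk (a b : A) : (a : A ⧸ B) = b ↔ a - b ∈ B := by
    rw [← sub_eq_zero, ← QuotientAddGroup.mk_sub, QuotientAddGroup.eq_zero_iff]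
  have hp1 {u v : κ} (huv : u ≠ v) (i i' j : Fin 3) :
      ((x u).link i (x v) j : A ⧸ B) = (x u).link i' (x v) j := by
    obtain ⟨t, ht, ht'⟩ := hthird u v
    exact (hmk _ _).mpr (Hub.link_sub_link_mem h (hx t) (hx u) (hx v) (hd ht) (hd huv) (hd ht') _ _ _)
  have hp {u v : κ} (huv : u ≠ v) (i j : Fin 3) : ((x u).link i (x v) j : A ⧸ B) = p u v := by
    rw [hp1 huv i 0, Hub.link_comm, hp1 huv.symm j 0, Hub.link_comm]
  have hsymm (u v : κ) : p u v = p v u := by simp only [p]; rw [Hub.link_comm]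
  have hadd {u v w : κ} (huv : u ≠ v) (hvw : v ≠ w) (huw : u ≠ w) : p u v + p v w = p u w := by
    rw [← hp hvw 1 0, ← QuotientAddGroup.mk_add]
    exact (hmk _ _).mpr (Hub.link_add_link_sub_mem h (hx u) (hx v) (hx w) (hd huv) (hd hvw)
      (hd huw) _ _ (by decide))
  -- For a third hub `t`, going from `t` to `v` and back to `u` equals going from `t` to `u`
  -- directly.
  have htwo {u v : κ} (huv : u ≠ v) : 2 • p u v = 0 := by
    obtain ⟨t, ht, ht'⟩ := hthird u v
    have h₁ := hadd ht huv ht'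
    have h₂ := hadd ht' huv.symm ht
    rw [hsymm v u, ← h₁, add_assoc, ← two_nsmul] at h₂
    simpa using h₂
  -- Hubs with the same class `q` as seen from `u₀` are at mutual distance `2q = 0`.
  obtain ⟨u₀⟩ : Nonempty κ := Fintype.card_pos_iff.mp (by omega)
  obtain ⟨q, -, hq⟩ := Finset.exists_lt_card_fiber_of_mul_lt_card_of_maps_to
    (s := Finset.univ.erase u₀) (t := {q : A ⧸ B | 2 • q = 0}.toFinset) (f := p u₀) (n := n)
    (fun u hu => by simpa using htwo (Finset.ne_of_mem_erase hu).symm) (by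
      rw [Finset.card_erase_of_mem (Finset.mem_univ _), Finset.card_univ,
        ← Set.ncard_eq_toFinset_card']
      have := Nat.mul_le_mul_right n (card_two_torsion_quotient_le B)
      rw [mul_comm (sigmaParam A)] at this
      omega)
  refine ⟨_, hq.le, fun u hu v hv huv i j => ?_⟩
  simp only [Finset.mem_filter, Finset.mem_erase, Finset.mem_univ, and_true] at hu hv
  rw [← QuotientAddGroup.eq_zero_iff, hp huv, ← hadd hu.1 hv.1.symm huv, hsymm u, hu.2, ← hv.2,
    ← two_nsmul, htwo hv.1.symm]

/-- Triviality modulo `C.sub` on chain and hubs together puts the weight of one route through the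
chain into `C.sub`, since the direct link lies there. The chain can vary this weight over all of
`C.sub`, in particular to zero. -/
theorem Chain.exists_run_eq_zero [DecidableEq ι] {R : RouteWeights ι A} (C : R.Chain)
    {N : Finset ι} (h : R.IsTrivialMod (C.nodes ∪ N) C.sub) (hC : Disjoint C.nodes N)
    {x y : R.Hub} (hx : x.nodes ⊆ N) (hy : y.nodes ⊆ N) (hxy : Disjoint x.nodes y.nodes)
    (i j : Fin 3) (hl : x.link i y j ∈ C.sub) :
    ∃ m : List ι, (x.ctr :: x.leaf i :: (m ++ [y.leaf j, y.ctr])).Nodup ∧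
      (∀ c ∈ m, c ∈ C.nodes) ∧
      x.leg i + R.run x.ctr (x.leaf i) (m ++ [y.leaf j, y.ctr]) + y.leg j = 0 := by
  have nodup_of {m : List ι} (hm : m.Nodup) (hmC : ∀ c ∈ m, c ∈ C.nodes) :
      (x.ctr :: x.leaf i :: (m ++ [y.leaf j, y.ctr])).Nodup := by
    have hne {c d : ι} (hc : c ∈ m) (hd : d ∈ (N : Set ι)) : c ≠ d := fun he =>
      Finset.disjoint_left.mp hC (hmC c hc) (he ▸ hd)
    have n₁ := hxy.ne_of_mem x.ctr_mem y.ctr_mem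
    have n₂ := hxy.ne_of_mem x.ctr_mem (y.leaf_mem j)
    have n₃ := hxy.ne_of_mem (x.leaf_mem i) y.ctr_mem
    have n₄ := hxy.ne_of_mem (x.leaf_mem i) (y.leaf_mem j)
    have m₁ : x.ctr ∉ m := fun hc => hne hc (hx x.ctr_mem) rfl
    have m₂ : x.leaf i ∉ m := fun hc => hne hc (hx (x.leaf_mem i)) rfl
    have m₃ : y.ctr ∉ m := fun hc => hne hc (hy y.ctr_mem) rfl
    have m₄ : y.leaf j ∉ m := fun hc => hne hc (hy (y.leaf_mem j)) rfl
    have m₅ := hm.append (l₂ := [y.leaf j, y.ctr]) (by simp [y.leaf_ne_ctr j]) (by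
      intro c hc hc'
      simp only [List.mem_cons, List.not_mem_nil, or_false] at hc'
      rcases hc' with rfl | rfl <;> contradiction)
    rw [List.nodup_cons, List.nodup_cons]
    exact ⟨by simp [n₁, n₂, m₁, (x.leaf_ne_ctr i).symm], by simp [n₃, n₄, m₂], m₅⟩
  -- the total weight is that of the chain up to a constant
  obtain ⟨c, hc⟩ : ∃ c, ∀ l : List ι, x.leg i + R.run x.ctr (x.leaf i)
      ((C.fst :: C.snd :: (l ++ [C.penult, C.last])) ++ [y.leaf j, y.ctr]) + y.leg j =
      c + R.run C.fst C.snd (l ++ [C.penult, C.last]) := by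
    refine ⟨x.leg i + (R.edge x.ctr (x.leaf i) + R.turn (x.leaf i) x.ctr C.fst) +
      (R.edge (x.leaf i) C.fst + R.turn C.fst (x.leaf i) C.snd) +
      (R.turn C.last C.penult (y.leaf j) + R.edge C.last (y.leaf j) +
        R.turn (y.leaf j) C.last y.ctr) + R.run (y.leaf j) y.ctr [] + y.leg j, fun l => ?_⟩
    have := R.run_append C.fst C.snd C.penult C.last (y.leaf j) y.ctr l []
    simp only [List.cons_append, List.append_assoc, List.nil_append, run] at this ⊢
    rw [this]
    abel
  obtain ⟨l₀, hl₀, hlC, hl₀'⟩ := C.attains C.base (by simp)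
  set m₀ := C.fst :: C.snd :: (l₀ ++ [C.penult, C.last]) with hm₀
  have hN : ∀ d ∈ x.ctr :: x.leaf i :: (m₀ ++ [y.leaf j, y.ctr]), d ∈ C.nodes ∪ N := by
    intro d hd
    simp only [List.mem_cons, List.mem_append, List.not_mem_nil, or_false] at hd
    rcases hd with rfl | rfl | hd | rfl | rfl
    · exact Finset.mem_union_right _ (hx x.ctr_mem)
    · exact Finset.mem_union_right _ (hx (x.leaf_mem i))
    · exact Finset.mem_union_left _ (hlC d hd)
    · exact Finset.mem_union_right _ (hy (y.leaf_mem j))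
    · exact Finset.mem_union_right _ (hy y.ctr_mem)
  have h₁ : c + C.base ∈ C.sub := by
    rw [← hl₀', ← hc]
    convert C.sub.add_mem
      (h.run_sub_mem x.ctr (x.leaf i) (y.leaf j) y.ctr m₀ (nodup_of hl₀ hlC) hN) hl using 1
    simp only [Hub.link]; abel
  obtain ⟨l, hl₁, hl₂, hl₃⟩ := C.attains (-c) (by
    have := C.sub.neg_mem h₁
    rwa [neg_add, ← sub_eq_add_neg] at this)
  exact ⟨_, nodup_of hl₁ hl₂, hl₂, by rw [hc, hl₃, add_neg_cancel]⟩

end RouteWeights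

/-! ### Weights of walks and tree paths in a supernode -/

namespace SimpleGraph

section Walks

variable {V A : Type*} [AddCommGroup A] {G : SimpleGraph V}

theorem Walk.IsPath.append {u v w : V} {p : G.Walk u v} {q : G.Walk v w} (hp : p.IsPath)
    (hq : q.IsPath) (h : ∀ x ∈ p.support, x ∈ q.support → x = v) : (p.append q).IsPath := by
  induction p with
  | nil => simpa using hq
  | cons hadj p ih =>
    rw [Walk.cons_isPath_iff] at hp
    rw [Walk.cons_append, Walk.cons_isPath_iff, Walk.mem_support_append_iff]
    refine ⟨ih hp.1 hq fun x hx => h x (by simp [hx]), ?_⟩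
    rintro (hx | hx)
    · exact hp.2 hx
    · have := h _ (by simp) hx
      exact hp.2 (this ▸ p.end_mem_support)

open Classical in
/-- The weights `w`, extended by zero to the pairs of vertices that are not edges. -/
noncomputable def extendWeight (w : G.edgeSet → A) (e : Sym2 V) : A :=
  if h : e ∈ G.edgeSet then w ⟨e, h⟩ else 0

theorem Walk.weight_eq (w : G.edgeSet → A) {u v : V} (p : G.Walk u v) :
    p.weight w = (p.edges.map (extendWeight w)).sum := by
  conv_rhs => rw [← List.attach_map_val (l := p.edges)]
  refine congrArg List.sum (List.map_congr_left fun e _ => ?_)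
  simp [extendWeight, p.edges_subset_edgeSet e.2]

theorem Walk.weight_cons (w : G.edgeSet → A) {u v z : V} (h : G.Adj u v) (p : G.Walk v z) :
    (Walk.cons h p).weight w = extendWeight w s(u, v) + p.weight w := by
  simp [Walk.weight_eq]

theorem Walk.weight_append (w : G.edgeSet → A) {u v z : V} (p : G.Walk u v) (q : G.Walk v z) :
    (p.append q).weight w = p.weight w + q.weight w := by
  simp [Walk.weight_eq]

theorem Walk.weight_reverse (w : G.edgeSet → A) {u v : V} (p : G.Walk u v) :
    p.reverse.weight w = p.weight w := by
  simp [Walk.weight_eq]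

theorem Walk.IsPath.exists_isPath_to_first_mem {S : Set V} {u v : V} {p : G.Walk u v} (hp : p.IsPath)
    (hv : v ∈ S) : ∃ z ∈ S, ∃ q : G.Walk u z, q.IsPath ∧ ∀ x ∈ q.support, x ∈ S → x = z := by
  induction p with
  | nil => exact ⟨_, hv, .nil, by simp, by simp⟩
  | @cons a b c hadj p ih =>
    by_cases ha : a ∈ S
    · exact ⟨a, ha, .nil, by simp, by simp⟩
    obtain ⟨z, hz, q, hq, hqS⟩ := ih hp.of_cons hv
    classical
    -- The induction does not record that `q` runs inside `p`, so `q` may pass through `a`; it is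
    -- then shortened.
    by_cases haq : a ∈ q.support
    · exact ⟨z, hz, q.dropUntil a haq, hq.dropUntil haq,
        fun x hx => hqS x (q.support_dropUntil_subset_support haq hx)⟩
    · refine ⟨z, hz, .cons hadj q, hq.cons haq, fun x hx hxS => ?_⟩
      rw [Walk.support_cons, List.mem_cons] at hx
      rcases hx with rfl | hx
      · exact absurd hxS ha
      · exact hqS x hx hxS

/-- Paths between the vertices of `X`, as in a tree on `X`. -/
structure TreePaths (G : SimpleGraph V) (X : Set V) where
  path : ∀ x y : X, G.Walk (x : V) y
  isPath : ∀ x y, (path x y).IsPath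
  support_subset : ∀ x y, ∀ z ∈ (path x y).support, z ∈ X
  reverse : ∀ x y, (path x y).reverse = path y x
  median : ∀ x : Fin 3 → X, ∃ v : X, ∀ i j, i ≠ j →
    (∀ z ∈ (path v (x i)).support, z ∈ (path v (x j)).support → z = v) ∧
    path (x i) (x j) = (path v (x i)).reverse.append (path v (x j))

theorem Connected.nonempty_treePaths {X : Set V} (h : (G.induce X).Connected) :
    Nonempty (TreePaths G X) := by
  classical
  obtain ⟨T, hT, hTree⟩ := h.exists_isTree_le
  have hex (x y : X) : ∃ p : T.Walk x y, p.IsPath ∧ ∀ q : T.Walk x y, q.IsPath → q = p :=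
    hTree.existsUnique_path x y
  choose p hp huniq using hex
  have hrev (x y : X) : (p x y).reverse = p y x := huniq _ _ _ (hp x y).reverse
  let φ : T →g G := (Embedding.induce X).toHom.comp (Hom.ofLE hT)
  have hφ : Function.Injective φ := Subtype.val_injective
  have hsupp (x y : X) (z : V) (hz : z ∈ ((p x y).map φ).support) :
      ∃ y' ∈ (p x y).support, φ y' = z := by
    rwa [Walk.support_map, List.mem_map] at hz
  have hmaprev (x y : X) : ((p x y).map φ).reverse = (p y x).map φ := by
    rw [← hrev x y, Walk.reverse_map]
  have hmapapp (v x y : X) (h : p x y = (p v x).reverse.append (p v y)) :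
      (p x y).map φ = ((p v x).map φ).reverse.append ((p v y).map φ) := by
    rw [h, Walk.map_append, Walk.reverse_map]
  have hmed (x : Fin 3 → X) : ∃ v : X, ∀ i j, i ≠ j →
      ∀ z ∈ (p v (x i)).support, z ∈ (p v (x j)).support → z = v := by
    -- The median is where the tree path from `x 2` first meets the one between `x 0` and `x 1`.
    obtain ⟨v, hv, q, hq, hqS⟩ := (hp (x 2) (x 0)).exists_isPath_to_first_mem
      (S := {z | z ∈ (p (x 0) (x 1)).support}) (by simp)
    have hv' : v ∈ (p (x 0) (x 1)).support := hv
    have h₀ : p v (x 0) = ((p (x 0) (x 1)).takeUntil v hv').reverse :=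
      (huniq _ _ _ ((hp _ _).takeUntil hv').reverse).symm
    have h₁ : p v (x 1) = (p (x 0) (x 1)).dropUntil v hv' :=
      (huniq _ _ _ ((hp _ _).dropUntil hv')).symm
    have h₂ : p v (x 2) = q.reverse := (huniq _ _ _ hq.reverse).symm
    have k₀ : ∀ z ∈ (p v (x 0)).support, z ∈ (p (x 0) (x 1)).support := fun z hz => by
      rw [h₀, Walk.support_reverse, List.mem_reverse] at hz
      exact Walk.support_takeUntil_subset_support _ _ hz
    have k₁ : ∀ z ∈ (p v (x 1)).support, z ∈ (p (x 0) (x 1)).support := fun z hz => by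
      rw [h₁] at hz
      exact Walk.support_dropUntil_subset_support _ _ hz
    have k₂ : ∀ z ∈ (p v (x 2)).support, z ∈ (p (x 0) (x 1)).support → z = v := fun z hz => by
      rw [h₂, Walk.support_reverse, List.mem_reverse] at hz
      exact hqS z hz
    have k₀₁ : ∀ z ∈ (p v (x 0)).support, z ∈ (p v (x 1)).support → z = v := fun z hz hz' => by
      rw [h₀, Walk.support_reverse, List.mem_reverse] at hz
      rw [h₁] at hz'
      by_contra hne
      have hpath : (((p (x 0) (x 1)).takeUntil v hv').append
          ((p (x 0) (x 1)).dropUntil v hv')).IsPath := by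
        rw [Walk.take_spec]; exact hp _ _
      exact hpath.ne_of_mem_support_of_append hne hz hz' rfl
    refine ⟨v, fun i j hij z hz hz' => ?_⟩
    fin_cases i <;> fin_cases j <;> first | exact absurd rfl hij | skip
    · exact k₀₁ z hz hz'
    · exact k₂ z hz' (k₀ z hz)
    · exact k₀₁ z hz' hz
    · exact k₂ z hz' (k₁ z hz)
    · exact k₂ z hz (k₀ z hz')
    · exact k₂ z hz (k₁ z hz')
  refine ⟨⟨fun x y => (p x y).map φ, fun x y => (hp x y).map hφ, ?_, ?_, ?_⟩⟩
  · intro x y z hz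
    obtain ⟨z', -, rfl⟩ := hsupp _ _ _ hz
    exact z'.2
  · exact hmaprev
  · intro x
    obtain ⟨v, hv⟩ := hmed x
    refine ⟨v, fun i j hij => ⟨fun z hz hz' => ?_, hmapapp _ _ _ ?_⟩⟩
    · obtain ⟨y, hy, rfl⟩ := hsupp _ _ _ hz
      obtain ⟨y', hy', he⟩ := hsupp _ _ _ hz'
      rw [hφ he] at hy'
      exact congrArg φ (hv i j hij y hy hy')
    · exact (huniq _ _ _ ((hp _ _).reverse.append (hp _ _) fun z hz hz' =>
          hv i j hij z (by simpa using hz) hz')).symm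

end Walks

/-! ### Realizing routes as paths -/

section Routes

variable {V A ι : Type*} [AddCommGroup A] {G : SimpleGraph V} {X : ι → Set V}

/-- Weights of routes through disjoint connected sets `X i`, where `τ i j` is the end in `X i` of
an edge from `X i` to `X j`. -/
noncomputable def routeWeights (w : G.edgeSet → A) (T : ∀ i, TreePaths G (X i))
    (τ : ∀ i, ι → X i) : RouteWeights ι A where
  edge i j := extendWeight w s((τ i j : V), (τ j i : V))
  turn i j k := ((T i).path (τ i j) (τ i k)).weight w
  edge_comm i j := by rw [Sym2.eq_swap]
  turn_comm i j k := by rw [← (T i).reverse, Walk.weight_reverse]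

/-- Tree paths and chosen edges are joined from the far end backwards. The first and last supernodes
are met in a single vertex, so that legs of hubs can be attached there. -/
theorem exists_path_of_nodup (w : G.edgeSet → A) (T : ∀ i, TreePaths G (X i))
    (τ : ∀ i, ι → X i) (hX : ∀ i j, i ≠ j → Disjoint (X i) (X j))
    (hτ : ∀ i j, i ≠ j → G.Adj (τ i j) (τ j i)) (p q k b : ι) (l : List ι)
    (hnd : (p :: q :: (l ++ [k, b])).Nodup) :
    ∃ P : G.Walk (τ p q : V) (τ b k), P.IsPath ∧
      P.weight w = (routeWeights w T τ).run p q (l ++ [k, b]) ∧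
      ∀ x ∈ P.support, ∃ c ∈ p :: q :: (l ++ [k, b]), x ∈ X c ∧ (c = p → x = τ p q) ∧
        (c = b → x = τ b k) := by
  have step : ∀ (p q r : ι) (l : List ι), (p :: q :: r :: l).Nodup → b ∈ r :: l →
      (∃ P : G.Walk (τ q r : V) (τ b k), P.IsPath ∧
        P.weight w = (routeWeights w T τ).run q r l ∧
        ∀ x ∈ P.support, ∃ c ∈ q :: r :: l, x ∈ X c ∧ (c = q → x = τ q r) ∧
          (c = b → x = τ b k)) →
      ∃ P : G.Walk (τ p q : V) (τ b k), P.IsPath ∧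
        P.weight w = (routeWeights w T τ).run p q (r :: l) ∧
        ∀ x ∈ P.support, ∃ c ∈ p :: q :: r :: l, x ∈ X c ∧ (c = p → x = τ p q) ∧
          (c = b → x = τ b k) := by
    rintro p q r l hnd hb ⟨P, hP, hPw, hPs⟩
    rw [List.nodup_cons, List.nodup_cons] at hnd
    obtain ⟨hp, hq, -⟩ := hnd
    have hpq : p ≠ q := fun he => hp (he ▸ List.mem_cons_self)
    have hqb : q ≠ b := fun he => hq (he ▸ hb)
    have hpb : p ≠ b := fun he => hp (he ▸ List.mem_cons_of_mem _ hb)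
    have hX' {c d : ι} {x : V} (hc : x ∈ X c) (hd : x ∈ X d) : c = d := by
      by_contra hne
      exact Set.disjoint_left.mp (hX c d hne) hc hd
    have hQ : (((T q).path (τ q p) (τ q r)).append P).IsPath := by
      refine ((T q).isPath _ _).append hP fun x hx hx' => ?_
      obtain ⟨c, -, hxc, hcq, -⟩ := hPs x hx'
      exact hcq (hX' hxc ((T q).support_subset _ _ x hx))
    refine ⟨.cons (hτ p q hpq) (((T q).path (τ q p) (τ q r)).append P), hQ.cons ?_, ?_, ?_⟩
    · rw [Walk.mem_support_append_iff]
      rintro (hx | hx)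
      · exact hpq (hX' (τ p q).2 ((T q).support_subset _ _ _ hx))
      · obtain ⟨c, hc, hxc, -⟩ := hPs _ hx
        exact hp (hX' (τ p q).2 hxc ▸ hc)
    · rw [Walk.weight_cons, Walk.weight_append, hPw, ← add_assoc]
      rfl
    · intro x hx
      rw [Walk.support_cons, List.mem_cons, Walk.mem_support_append_iff] at hx
      rcases hx with rfl | hx | hx
      · exact ⟨p, List.mem_cons_self, (τ p q).2, fun _ => rfl, fun he => absurd he hpb⟩
      · exact ⟨q, by simp, (T q).support_subset _ _ x hx, fun he => absurd he.symm hpq,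
          fun he => absurd he hqb⟩
      · obtain ⟨c, hc, hxc, -, hcb⟩ := hPs x hx
        exact ⟨c, List.mem_cons_of_mem _ hc, hxc, fun he => absurd (he ▸ hc) hp, hcb⟩
  have base : k ≠ b → ∃ P : G.Walk (τ k b : V) (τ b k), P.IsPath ∧
        P.weight w = (routeWeights w T τ).run k b [] ∧
        ∀ x ∈ P.support, ∃ c ∈ [k, b], x ∈ X c ∧ (c = k → x = τ k b) ∧
          (c = b → x = τ b k) := by
    intro hkb
    refine ⟨(hτ k b hkb).toWalk, Walk.IsPath.of_adj _, ?_, ?_⟩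
    · simp [Walk.weight_eq, RouteWeights.run, routeWeights]
    · intro x hx
      simp only [Walk.support_cons, Walk.support_nil, List.mem_cons, List.not_mem_nil,
        or_false] at hx
      rcases hx with rfl | rfl
      · exact ⟨k, by simp, (τ k b).2, fun _ => rfl, fun he => absurd he hkb⟩
      · exact ⟨b, by simp, (τ b k).2, fun he => absurd he.symm hkb, fun _ => rfl⟩
  induction l generalizing p q with
  | nil =>
    refine step p q k [b] hnd (by simp) (step q k b [] hnd.of_cons (by simp) (base ?_))
    have := hnd.of_cons.of_cons
    simpa using this
  | cons r l ih => exact step p q r _ hnd (by simp) (ih q r hnd.of_cons)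

end Routes

end SimpleGraph

/-! ### Assembling the subdivision -/

namespace SimpleGraph

/-- `Q e` is the region allotted to the edge `e`: paths chosen inside such regions need no further
comparison. A linear order on `U` selects one orientation of each edge, the other getting the
reversed path. -/
theorem exists_divisible_subdivision {U V A : Type*} [AddCommGroup A] {H : SimpleGraph U}
    {G : SimpleGraph V} (w : G.edgeSet → A) (branch : U → V)
    (hinj : Function.Injective branch) (Q : Sym2 U → V → Prop)
    (hpath : ∀ u v, H.Adj u v → ∃ P : G.Walk (branch u) (branch v), P.IsPath ∧ P.weight w = 0 ∧
      ∀ x ∈ P.support, Q s(u, v) x)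
    (hend : ∀ u v, H.Adj u v → ∀ z, Q s(u, v) (branch z) → z = u ∨ z = v)
    (hdisj : ∀ e ∈ H.edgeSet, ∀ e' ∈ H.edgeSet, e ≠ e' → ∀ x, Q e x → Q e' x →
      x ∈ Set.range branch) :
    ∃ S : H.SubdivisionIn G, S.IsDivisible w := by
  classical
  let := linearOrderOfSTO (WellOrderingRel (α := U))
  choose P hP hw hQ using hpath
  let p (u v : U) (h : H.Adj u v) : G.Walk (branch u) (branch v) :=
    if u < v then P u v h else (P v u h.symm).reverse
  have hp (u v : U) (h : H.Adj u v) : (p u v h).IsPath ∧ (p u v h).weight w = 0 ∧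
      ∀ x ∈ (p u v h).support, Q s(u, v) x := by
    simp only [p]
    split_ifs
    · exact ⟨hP u v h, hw u v h, hQ u v h⟩
    · refine ⟨(hP v u h.symm).reverse, by rw [Walk.weight_reverse, hw], fun x hx => ?_⟩
      rw [Sym2.eq_swap]
      exact hQ v u h.symm x (by simpa using hx)
  refine ⟨⟨branch, hinj, p, fun u v h => (hp u v h).1, fun u v h => ?_,
    fun u v h z hz => hend u v h z ((hp u v h).2.2 _ hz),
    fun u v h u' v' h' hne x hx hx' => hdisj _ h _ h' hne x ((hp u v h).2.2 x hx)
      ((hp u' v' h').2.2 x hx')⟩, fun u v h => (hp u v h).2.1⟩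
  simp only [p]
  rcases lt_or_gt_of_ne h.ne with hlt | hlt
  · rw [if_pos hlt, if_neg hlt.asymm]
  · rw [if_pos hlt, if_neg hlt.asymm, Walk.reverse_reverse]

theorem CliqueMinor.exists_ends {V : Type*} {G : SimpleGraph V} {f : ℕ} (M : G.CliqueMinor f) :
    ∃ τ : ∀ i, Fin f → M.supernode i, ∀ i j, i ≠ j → G.Adj (τ i j) (τ j i) := by
  choose x hx y hy hadj using M.adj
  choose z hz using M.nonempty
  refine ⟨fun i j => if h : i < j then ⟨x i j h.ne, hx i j h.ne⟩ else if h : j < i then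
    ⟨y j i h.ne, hy j i h.ne⟩ else ⟨z i, hz i⟩, fun i j hij => ?_⟩
  rcases lt_or_gt_of_ne hij with h | h
  · simpa [h, h.asymm] using hadj i j h.ne
  · simpa [h, h.asymm] using (hadj j i h.ne).symm

theorem exists_leaf_assignment {U : Type*} [Fintype U] (H : SimpleGraph U)
    [DecidableRel H.Adj] (hH : ∀ u, H.degree u ≤ 3) :
    ∃ lf : U → U → Fin 3, ∀ u v v', H.Adj u v → H.Adj u v' → lf u v = lf u v' → v = v' := by
  classical
  have hemb (u : U) : Nonempty (H.neighborSet u ↪ Fin 3) :=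
    Function.Embedding.nonempty_of_card_le (by
      rw [H.card_neighborSet_eq_degree, Fintype.card_fin]; exact hH u)
  refine ⟨fun u v => if h : H.Adj u v then (hemb u).some ⟨v, h⟩ else 0, fun u v v' h h' he => ?_⟩
  simp only [dif_pos h, dif_pos h'] at he
  exact congrArg Subtype.val ((hemb u).some.injective he)

end SimpleGraph

open SimpleGraph in
theorem theorem1p3 {U : Type*} [Fintype U] [DecidableEq U] (H : SimpleGraph U)
    [DecidableRel H.Adj] (hH : ∀ u, H.degree u ≤ 3)
    {A : Type*} [AddCommGroup A] [Finite A]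
    {V : Type*} (G : SimpleGraph V) (w : G.edgeSet → A)
    (f : ℕ) (M : G.CliqueMinor f)
    (hf : 7 * H.edgeFinset.card * Nat.card A + 4 * Fintype.card U * sigmaParam A
      + 14 * Nat.card A ≤ f) :
    ∃ S : H.SubdivisionIn G, S.IsDivisible w := by
  classical
  obtain ⟨τ, hτ⟩ := M.exists_ends
  have T (i : Fin f) : TreePaths G (M.supernode i) := (M.connected i).nonempty_treePaths.some
  obtain ⟨lf, hlf⟩ := H.exists_leaf_assignment hH
  have hX {c d : Fin f} {x : V} (hc : x ∈ M.supernode c) (hd : x ∈ M.supernode d) : c = d := by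
    by_contra hne
    exact Set.disjoint_left.mp (M.disjoint c d hne) hc hd
  set R := routeWeights w T τ with hR
  -- disjoint chains, one for each edge of `H`
  obtain ⟨C, N, -, B, -, hNB, hNcard, -, hBC, hCN, hCC, hCtriv⟩ :=
    RouteWeights.IsTrivialMod.exists_chains (R := R) (N := Finset.univ) (B := ⊤)
      (4 * (Fintype.card U * sigmaParam A)) H.edgeFinset.card
      (fun _ _ _ _ _ _ _ => AddSubgroup.mem_top _) (by
        rw [AddSubgroup.card_top, Finset.card_univ, Fintype.card_fin]
        linarith)
  obtain ⟨k⟩ : Nonempty (H.edgeSet ≃ Fin H.edgeFinset.card) :=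
    ⟨Fintype.equivFinOfCardEq H.edgeFinset_card.symm⟩
  -- disjoint hubs in the remaining nodes
  obtain ⟨g⟩ : Nonempty (Fin (Fintype.card U * sigmaParam A + 3) × Fin 4 ↪ N) :=
    Function.Embedding.nonempty_of_card_le (by simp; omega)
  have hg {p q} (h : (g p : Fin f) = g q) : p = q := g.injective (Subtype.ext h)
  -- The branch vertex is the median of the three exits from the centre towards the leaves, so
  -- distinct legs meet only there.
  choose b hb using fun u =>
    (T (g (u, 0))).median fun i : Fin 3 => τ (g (u, 0)) (g (u, i.succ))
  let y (u : Fin (Fintype.card U * sigmaParam A + 3)) : R.Hub :=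
    { ctr := g (u, 0)
      leaf := fun i => g (u, i.succ)
      leg := fun i => ((T (g (u, 0))).path (b u) (τ (g (u, 0)) (g (u, i.succ)))).weight w
      leaf_injective := fun i j h => Fin.succ_injective _ (Prod.ext_iff.mp (hg h)).2
      leaf_ne_ctr := fun i h => Fin.succ_ne_zero i (Prod.ext_iff.mp (hg h)).2
      leg_add := fun i j hij => by
        simp only [hR, routeWeights]
        rw [(hb u i j hij).2, Walk.weight_append, Walk.weight_reverse] }
  have hy (u) {c} (hc : c ∈ (y u).nodes) : ∃ i, c = g (u, i) := by
    rcases hc with rfl | ⟨i, rfl⟩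
    · exact ⟨0, rfl⟩
    · exact ⟨i.succ, rfl⟩
  have hyN (u) : (y u).nodes ⊆ N := fun c hc => by
    obtain ⟨i, rfl⟩ := hy u hc
    exact (g (u, i)).2
  have hyu {u v c} (hc : c ∈ (y u).nodes) (hc' : c ∈ (y v).nodes) : u = v := by
    obtain ⟨i, rfl⟩ := hy u hc
    obtain ⟨j, hj⟩ := hy v hc'
    exact (Prod.ext_iff.mp (hg hj)).1
  have hyd : Pairwise fun u v => Disjoint (y u).nodes (y v).nodes := fun u v huv =>
    Set.disjoint_left.mpr fun c hc hc' => huv (hyu hc hc')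
  obtain ⟨s, hs, hlink⟩ := hNB.exists_hubs y hyN hyd (Fintype.card U) (by simp)
  obtain ⟨φ⟩ : Nonempty (U ↪ s) := Function.Embedding.nonempty_of_card_le (by simpa using hs)
  have hφ {u v : U} (h : (φ u).1 = (φ v).1) : u = v := φ.injective (Subtype.ext h)
  let leg (u : U) (i : Fin 3) := (T (y (φ u)).ctr).path (b (φ u)) (τ (y (φ u)).ctr ((y (φ u)).leaf i))
  have hleg (u : U) (i : Fin 3) {x : V} (hx : x ∈ (leg u i).support) :
      x ∈ M.supernode (y (φ u)).ctr := (T _).support_subset _ _ x hx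
  -- the nodes used by the path of an edge
  let Q (e : Sym2 U) (x : V) : Prop := ∃ c, x ∈ M.supernode c ∧
    ((∃ h : e ∈ H.edgeSet, c ∈ (C (k ⟨e, h⟩)).nodes) ∨
      ∃ u v, s(u, v) = e ∧ (c = (y (φ u)).leaf (lf u v) ∨
        c = (y (φ u)).ctr ∧ x ∈ (leg u (lf u v)).support))
  refine exists_divisible_subdivision w (fun u => (b (φ u) : V)) ?_ Q ?_ ?_ ?_
  · intro u v huv
    have : (b (φ u) : V) ∈ M.supernode (y (φ v)).ctr := by
      simp only at huv
      rw [huv]; exact (b (φ v)).2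
    have h : (y (φ u)).ctr = (y (φ v)).ctr := hX (b (φ u)).2 this
    exact hφ (hyu (y (φ u)).ctr_mem (h ▸ (y (φ v)).ctr_mem))
  · intro u v h
    have huv : (φ u).1 ≠ (φ v).1 := fun he => h.ne (hφ he)
    have hctr : (y (φ u)).ctr ≠ (y (φ v)).ctr := (hyd huv).ne_of_mem (y _).ctr_mem (y _).ctr_mem
    obtain ⟨m, hnd, hmC, hm⟩ := (C (k ⟨s(u, v), h⟩)).exists_run_eq_zero (hCtriv _) (hCN _)
      (hyN (φ u)) (hyN (φ v)) (hyd huv) (lf u v) (lf v u)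
      (hBC _ (hlink _ (φ u).2 _ (φ v).2 huv _ _))
    obtain ⟨P, hP, hPw, hPs⟩ := exists_path_of_nodup w T τ M.disjoint hτ _ _ _ _ m hnd
    refine ⟨(leg u (lf u v)).append (P.append (leg v (lf v u)).reverse), ?_, ?_, ?_⟩
    · refine ((T _).isPath _ _).append (hP.append ((T _).isPath _ _).reverse ?_) ?_
      · intro x hx hx'
        obtain ⟨c, -, hxc, -, hc⟩ := hPs x hx
        rw [Walk.support_reverse, List.mem_reverse] at hx'
        exact hc (hX hxc (hleg v _ hx'))
      · intro x hx hx'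
        rw [Walk.mem_support_append_iff, Walk.support_reverse, List.mem_reverse] at hx'
        rcases hx' with hx' | hx'
        · obtain ⟨c, -, hxc, hc, -⟩ := hPs x hx'
          exact hc (hX hxc (hleg u _ hx))
        · exact absurd (hX (hleg u _ hx) (hleg v _ hx')) hctr
    · rw [Walk.weight_append, Walk.weight_append, Walk.weight_reverse, hPw, ← add_assoc]
      exact hm
    · intro x hx
      rw [Walk.mem_support_append_iff, Walk.mem_support_append_iff, Walk.support_reverse,
        List.mem_reverse] at hx
      rcases hx with hx | hx | hx
      · exact ⟨_, hleg u _ hx, Or.inr ⟨u, v, rfl, Or.inr ⟨rfl, hx⟩⟩⟩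
      · obtain ⟨c, hc, hxc, hcu, hcv⟩ := hPs x hx
        refine ⟨c, hxc, ?_⟩
        simp only [List.mem_cons, List.mem_append, List.not_mem_nil, or_false] at hc
        rcases hc with hc | hc | hc | hc | hc
        · exact Or.inr ⟨u, v, rfl, Or.inr ⟨hc, hcu hc ▸ (leg u (lf u v)).end_mem_support⟩⟩
        · exact Or.inr ⟨u, v, rfl, Or.inl hc⟩
        · exact Or.inl ⟨h, hmC c hc⟩
        · exact Or.inr ⟨v, u, Sym2.eq_swap, Or.inl hc⟩
        · exact Or.inr ⟨v, u, Sym2.eq_swap, Or.inr ⟨hc, hcv hc ▸ (leg v (lf v u)).end_mem_support⟩⟩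
      · exact ⟨_, hleg v _ hx, Or.inr ⟨v, u, Sym2.eq_swap, Or.inr ⟨rfl, hx⟩⟩⟩
  · rintro u v h z ⟨c, hxc, hc⟩
    obtain rfl : c = (y (φ z)).ctr := hX hxc (b (φ z)).2
    rcases hc with ⟨_, hc⟩ | ⟨u', v', he, hc⟩
    · exact absurd (hyN (φ z) (y (φ z)).ctr_mem) (Finset.disjoint_left.mp (hCN _) hc)
    · have hz : z = u' := by
        rcases hc with hc | ⟨hc, -⟩
        · exact hφ (hyu (y (φ z)).ctr_mem (hc ▸ (y (φ u')).leaf_mem _))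
        · exact hφ (hyu (y (φ z)).ctr_mem (hc ▸ (y (φ u')).ctr_mem))
      subst hz
      rcases Sym2.eq_iff.mp he with ⟨h, -⟩ | ⟨h, -⟩
      · exact Or.inl h
      · exact Or.inr h
  · rintro e he e' he' hne x ⟨c, hxc, hc⟩ ⟨c', hxc', hc'⟩
    obtain rfl := hX hxc hxc'
    have hnot {e : H.edgeSet} {u v : U} (hc : c ∈ (C (k e)).nodes)
        (hc' : c = (y (φ u)).leaf (lf u v) ∨
          c = (y (φ u)).ctr ∧ x ∈ (leg u (lf u v)).support) : False := by
      refine Finset.disjoint_left.mp (hCN _) hc ?_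
      rcases hc' with rfl | ⟨rfl, -⟩
      · exact hyN _ ((y (φ u)).leaf_mem _)
      · exact hyN _ (y (φ u)).ctr_mem
    rcases hc with ⟨_, hc⟩ | ⟨u, v, rfl, hc⟩ <;> rcases hc' with ⟨_, hc'⟩ | ⟨u', v', rfl, hc'⟩
    · exact absurd hc' (Finset.disjoint_left.mp
        (hCC _ _ fun h => hne (Subtype.ext_iff.mp (k.injective h))) hc)
    · exact (hnot hc hc').elim
    · exact (hnot hc' hc).elim
    · have hmem {u v : U} (hc : c = (y (φ u)).leaf (lf u v) ∨
          c = (y (φ u)).ctr ∧ x ∈ (leg u (lf u v)).support) : c ∈ (y (φ u)).nodes := by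
        rcases hc with rfl | ⟨rfl, -⟩
        · exact (y (φ u)).leaf_mem _
        · exact (y (φ u)).ctr_mem
      obtain rfl : u = u' := hφ (hyu (hmem hc) (hmem hc'))
      -- Different edges at `u` use different leaves, so their regions can meet only where two legs
      -- do, at the branch vertex.
      have hlne : lf u v ≠ lf u v' := fun h => hne (by rw [hlf u v v' he he' h])
      rcases hc with hc | ⟨hc, hx⟩ <;> rcases hc' with hc' | ⟨hc', hx'⟩
      · exact absurd ((y (φ u)).leaf_injective (hc.symm.trans hc')) hlne
      · exact absurd (hc.symm.trans hc') ((y (φ u)).leaf_ne_ctr _)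
      · exact absurd (hc'.symm.trans hc) ((y (φ u)).leaf_ne_ctr _)
      · exact ⟨u, ((hb (φ u) _ _ hlne).1 x hx hx').symm⟩
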